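/- Let $A$ be a set, let $m_{a,b}=m_{b,a}\in\{2,3,\dots\}\cup\{\infty\}$ for distinct $a,b\in A$, and let $P$ be the Artin–Tits monoid generated by $A$ with relations $aba\cdots=bab\cdots$ ($m_{a,b}$ letters on each side) for all distinct $a,b$ with $m_{a,b}<\infty$. Assume that $P$ is finitely generated, irreducible (the Coxeter graph on $A$, in which distinct $a,b$ are joined when $m_{a,b}\neq 2$, is connected), and non-spherical (the associated Coxeter group is infinite). Write $a\preceq b$ if $b\in aP$, let $P^*$ be the group of invertible elements of $P$, and for $S\subseteq P$ put $S^\sharp=SP^*\cup P^*$. A finite sequence $s_1,\dots,s_l$ in $S^\sharp$ is called normal if for all $1\le k<l$ and $r\in S$, $r\preceq s_ks_{k+1}$ implies $r\preceq s_k$. The set $S$ is a Garside family if (1) for all $r,s\in S$ and $a\in P$ with $r\preceq a$, $s\preceq a$ there is $t\in S$ with $r\preceq t$, $s\preceq t$, $t\preceq a$; (2) $S\cup P^*$ generates $P$; (3) $S^\sharp$ is closed under right divisors; and (4) every element of $P$ is the product of a normal sequence. The head $H(a)$ of a non-invertible $a\in P$ is the element $s\in S$ with $s\preceq a$ such that $r\preceq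 s$ for all $r\in S$ with $r\preceq a$. Let $S\subseteq P$ be a finite Garside family and let $T\subseteq S$ be a non-empty subset such that the pair $(T,\emptyset)$ is - admissible: for every $t\in T$ there is $t'\in T$ such that $t,t'$ is normal; - $H$-invariant: $H(ax)\in T$ for all $a\in P\setminus P^*$ and $x\in T$; - $\max_{\preceq}^{\infty}$-closed: for every sequence $(t_i)_{i\in\mathbb N}$ in $T$, every $s\in S$ that is maximal with respect to $\preceq$ in $\{r\in S\cup\{1\} : r\preceq t_i \text{ for all but finitely many } i\}$ belongs to $T$. Then $A\subseteq T$, and hence $T=S$. -/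

import Mathlib

/-! ## Garside families in a monoid

A monoid `P` is regarded as a category with one object: all products are defined, the set of
objects (identities) is `{1}`, and the invertible elements are the units.  Left divisibility
`a ⪯ b` (that is, `b ∈ a P`) is Mathlib's `a ∣ b`, which unfolds to `∃ c, b = a * c`. -/

namespace Garside

variable {P : Type*} [Monoid P]

/-- The set `S P* ∪ P*`, where `P*` is the set of invertible elements. -/
def sharp (S : Set P) : Set P :=
  {x | (∃ s ∈ S, ∃ u : P, IsUnit u ∧ x = s * u) ∨ IsUnit x}

/-- Every common right multiple in `P` of two elements of `S` is a right multiple of a common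
right multiple that lies in `S`. -/
def ClosedUnderRightComultiples (S : Set P) : Prop :=
  ∀ r ∈ S, ∀ s ∈ S, ∀ a : P, r ∣ a → s ∣ a → ∃ t ∈ S, r ∣ t ∧ s ∣ t ∧ t ∣ a

/-- Every right divisor of an element of `X` lies in `X`. -/
def ClosedUnderRightDivisors (X : Set P) : Prop :=
  ∀ a b : P, a * b ∈ X → b ∈ X

/-- A finite path `s₁, …, s_l` with entries in `sharp S` is normal if every `r ∈ S` that left
divides `s_k s_{k+1}` already left divides `s_k`. -/
def IsNormalPath (S : Set P) (l : List P) : Prop :=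
  (∀ s ∈ l, s ∈ sharp S) ∧ l.IsChain (fun s t => ∀ r ∈ S, r ∣ s * t → r ∣ s)

/-- Garside families. -/
structure IsGarsideFamily (S : Set P) : Prop where
  comultiples : ClosedUnderRightComultiples S
  generates : Submonoid.closure (S ∪ {u : P | IsUnit u}) = ⊤
  rightDivisors : ClosedUnderRightDivisors (sharp S)
  exists_normal : ∀ a : P, ∃ l : List P, IsNormalPath S l ∧ l.prod = a

/-- `s` is an `S`-head of `a`: an element of `S` that left divides `a` and is left divisible by
every element of `S` that left divides `a`. -/
def IsHead (S : Set P) (a s : P) : Prop :=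
  s ∈ S ∧ s ∣ a ∧ ∀ r ∈ S, r ∣ a → r ∣ s

/-- The elements of `S ∪ {1}` that left divide all but finitely many terms of `t`. -/
def eventualDivisors (S : Set P) (t : ℕ → P) : Set P :=
  {r | r ∈ S ∪ {1} ∧ ∀ᶠ i in Filter.atTop, r ∣ t i}

/-- `lim t = s`: `s` is a maximal element, for left divisibility, of `eventualDivisors S t`. -/
def IsLim (S : Set P) (t : ℕ → P) (s : P) : Prop :=
  s ∈ eventualDivisors S t ∧ ∀ r ∈ eventualDivisors S t, s ∣ r → r ∣ s

/-! The following conditions concern pairs `(T, D)` with `T ⊆ S` and `D ⊆ {1}`. -/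

/-- Admissible pairs. -/
def Admissible (S T D : Set P) : Prop :=
  ∀ t ∈ T, (∃ t' ∈ T, IsNormalPath S [t, t']) ∨ (1 : P) ∈ D

/-- `H`-invariant pairs: the head of `a x` lies in `T` for all non-invertible `a` and all
`x ∈ T ∪ D`. -/
def HInvariant (S T D : Set P) : Prop :=
  ∀ a : P, ¬ IsUnit a → ∀ x ∈ T ∪ D, ∀ s : P, IsHead S (a * x) s → s ∈ T

/-- Pairs containing the limits in `S` of sequences in `T`. -/
def MaxClosed (S T D : Set P) : Prop :=
  ∀ t : ℕ → P, (∀ i, t i ∈ T) → ∀ s ∈ S, IsLim S t s → s ∈ T ∪ D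

end Garside

/-! ## Artin-Tits monoids

As in Mathlib, an entry `0` of a Coxeter matrix stands for `∞`. -/

namespace CoxeterMatrix

variable {A : Type*} (M : CoxeterMatrix A)

/-- The relations `a b a ⋯ = b a b ⋯` with `M a b` letters on both sides.  For `M a b = 0` and
for `a = b` both sides are the same word. -/
def ArtinTitsRel (u v : FreeMonoid A) : Prop :=
  ∃ a b : A, u = FreeMonoid.ofList (CoxeterSystem.braidWord M a b) ∧
    v = FreeMonoid.ofList (CoxeterSystem.braidWord M b a)

/-- The Artin-Tits monoid of a Coxeter matrix. -/
abbrev ArtinTitsMonoid : Type _ := PresentedMonoid M.ArtinTitsRel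

/-- The generators of the Artin-Tits monoid; they are its atoms. -/
def atom (a : A) : M.ArtinTitsMonoid := PresentedMonoid.of M.ArtinTitsRel a

/-- The Coxeter graph: distinct `a`, `b` are joined by an edge unless `M a b = 2`. -/
def coxeterGraph : SimpleGraph A where
  Adj a b := a ≠ b ∧ M a b ≠ 2
  symm := ⟨fun a b h => ⟨h.1.symm, fun e => h.2 ((M.symmetric a b).trans e)⟩⟩
  loopless := ⟨fun _ h => h.1 rfl⟩

/-- The Artin-Tits monoid is irreducible if its Coxeter graph is connected. -/
def IsIrreducible : Prop := M.coxeterGraph.Connected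

/-- The Artin-Tits monoid is spherical if the associated Coxeter group is finite. -/
def IsSpherical : Prop := Finite M.Group

end CoxeterMatrix

/-!
The argument has two parts.

*The combinatorics of Artin-Tits monoids.*  What is needed about `P` is that atoms can be cancelled
on the left (`CoxeterSystem.atom_mul_left_cancel`), that the common right multiples of two atoms
are the multiples of the two sides of their braid relation (`CoxeterSystem.braidWord_dvd`), and
that only in the spherical case some element is divisible by all atoms
(`CoxeterSystem.finite_of_forall_atom_dvd`).  All three are read off from the Coxeter group `W`.
The geometric representation of `W` shows that a simple root `α_s` is sent to a nonnegative vector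
by `w` when `w s` is longer than `w`, and to a nonpositive one otherwise
(`CoxeterSystem.geomRep_nonneg_of_not_isRightDescent`).  This controls lengths in cosets of
dihedral subgroups, whence Matsumoto's theorem, which lifts `W` to `P`, and the existence of a
greatest prefix of `w ∈ W` without a given left descent.  With such prefixes the atoms act on
`W × P` so that the braid relations hold, and the orbit of `(1, 1)` attaches to each `x ∈ P` a head
in `W` and a tail in `P` whose product is `x`.  The atoms dividing `x` are the left descents of its
head, and `x` can be recovered from the head and tail of `a x`.

*The conditions on `T`* (`CoxeterMatrix.atom_mem_of_hInvariant_of_maxClosed`).  Fix an atom `b`.  By `H`-invariance some elements of `T` are divisible by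
`b`; let `x = b x'` be a shortest one.  For `y ∈ T` the head of `b y` lies in `T`, and a limit of
the sequence alternating between `x` and this head is a common divisor of both that lies in `T` and
is divisible by `b`.  By minimality it is `x`, so `x` divides `b y` and `x'` divides `y`, for all
`y ∈ T`.  If `x' ≠ 1`, then some atom `c` divides all elements of `T`.  If `d` is adjacent to `c` in
the Coxeter graph, then `c` divides the head of `d c y` for each `y ∈ T`, hence `d c y` itself, and
this forces `d` to divide `y`.  By connectedness all atoms divide the elements of `T`,
contradicting non-sphericity.  So `x' = 1` and `b ∈ T`.  An element `s' b ≠ b` of `S` is its own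
head, hence belongs to `T`, and `1` is a limit of a sequence alternating between two atoms.
-/

/-! ### The geometric representation -/

namespace CoxeterMatrix

variable {A : Type*} (M : CoxeterMatrix A)

/-- The linear form `v ↦ 2 B(αₐ, v)` on the space with basis the simple roots `α_b`, where
`B(αₐ, α_b) = - cos (π / M a b)`.  The convention `π / 0 = 0` gives the value `B(αₐ, α_b) = -1`
that is customary for `M a b = ∞`. -/
noncomputable def rootForm (a : A) : (A →₀ ℝ) →ₗ[ℝ] ℝ :=
  Finsupp.linearCombination ℝ fun b => -(2 * Real.cos (Real.pi / M a b))

/-- The reflection `v ↦ v - 2 B(αₐ, v) αₐ` in the simple root `αₐ`. -/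
noncomputable def simpleReflection (a : A) : Module.End ℝ (A →₀ ℝ) :=
  LinearMap.id - (M.rootForm a).smulRight (Finsupp.single a 1)

theorem simpleReflection_apply (a : A) (v : A →₀ ℝ) :
    M.simpleReflection a v = v - M.rootForm a v • Finsupp.single a 1 := by
  simp [simpleReflection]

theorem rootForm_single (a b : A) :
    M.rootForm a (Finsupp.single b 1) = -(2 * Real.cos (Real.pi / M a b)) := by
  simp [rootForm]

theorem rootForm_single_self (a : A) : M.rootForm a (Finsupp.single a 1) = 2 := by
  simp [rootForm_single]

theorem simpleReflection_single_self (a : A) :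
    M.simpleReflection a (Finsupp.single a 1) = -Finsupp.single a 1 := by
  rw [simpleReflection_apply, rootForm_single_self, two_smul]; abel

theorem simpleReflection_mul_self (a : A) : M.simpleReflection a * M.simpleReflection a = 1 := by
  refine LinearMap.ext fun v => ?_
  simp only [Module.End.mul_apply, simpleReflection_apply, map_sub, map_smul,
    rootForm_single_self, Module.End.one_apply]
  module

theorem simpleReflection_of_rootForm_eq_zero {a : A} {v : A →₀ ℝ} (h : M.rootForm a v = 0) :
    M.simpleReflection a v = v := by
  simp [simpleReflection_apply, h]

/-- The numbers `sin (k θ) / sin θ`, given by their recursion so that `θ = 0` is allowed. -/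
noncomputable def dihedralCoeff (θ : ℝ) : ℕ → ℝ
  | 0 => 0
  | 1 => 1
  | k + 2 => 2 * Real.cos θ * dihedralCoeff θ (k + 1) - dihedralCoeff θ k

theorem dihedralCoeff_mul_sin (θ : ℝ) (k : ℕ) :
    dihedralCoeff θ k * Real.sin θ = Real.sin (k * θ) := by
  induction k using Nat.twoStepInduction with
  | zero => simp [dihedralCoeff]
  | one => simp [dihedralCoeff]
  | more k h0 h1 =>
    have e2 : ((k + 2 : ℕ) : ℝ) * θ = ((k + 1 : ℕ) : ℝ) * θ + θ := by push_cast; ring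
    have e0 : (k : ℝ) * θ = ((k + 1 : ℕ) : ℝ) * θ - θ := by push_cast; ring
    rw [dihedralCoeff, sub_mul, mul_assoc, h1, h0, e2, e0, Real.sin_add, Real.sin_sub]
    ring

theorem dihedralCoeff_zero_left (k : ℕ) : dihedralCoeff 0 k = k := by
  induction k using Nat.twoStepInduction with
  | zero => simp [dihedralCoeff]
  | one => simp [dihedralCoeff]
  | more k h0 h1 =>
    rw [dihedralCoeff, h0, h1, Real.cos_zero]; push_cast; ring

theorem sin_pi_div_pos {m : ℕ} (hm : 2 ≤ m) : 0 < Real.sin (Real.pi / m) := by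
  have h2 : (2 : ℝ) ≤ m := by exact_mod_cast hm
  apply Real.sin_pos_of_pos_of_lt_pi
  · have := Real.pi_pos; positivity
  · exact div_lt_self Real.pi_pos (by linarith)

theorem dihedralCoeff_nonneg {m k : ℕ} (hm : m ≠ 1) (hk : m = 0 ∨ k ≤ m) :
    0 ≤ dihedralCoeff (Real.pi / m) k := by
  rcases Nat.eq_zero_or_pos m with rfl | hpos
  · simp [dihedralCoeff_zero_left]
  · have hs := sin_pi_div_pos (m := m) (by omega)
    refine nonneg_of_mul_nonneg_left ?_ hs
    rw [dihedralCoeff_mul_sin]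
    have hm0 : (0 : ℝ) < m := by exact_mod_cast hpos
    have hkm : (k : ℝ) ≤ m := by exact_mod_cast (show k ≤ m by omega)
    apply Real.sin_nonneg_of_nonneg_of_le_pi
    · have := Real.pi_pos; positivity
    · rw [mul_div_assoc', div_le_iff₀ hm0, mul_comm]
      exact mul_le_mul_of_nonneg_left hkm Real.pi_pos.le

/-- An alternating word in `i`, `j` sends `αᵢ` to a combination of `αᵢ` and `αⱼ` whose
coefficients are two consecutive values of `dihedralCoeff`. -/
theorem prod_alternatingWord_apply_single (i j : A) (k : ℕ) :
    ((CoxeterSystem.alternatingWord i j k).map M.simpleReflection).prod (Finsupp.single i 1) =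
      if Even k then
        dihedralCoeff (Real.pi / M i j) (k + 1) • Finsupp.single i 1 +
          dihedralCoeff (Real.pi / M i j) k • Finsupp.single j 1
      else
        dihedralCoeff (Real.pi / M i j) k • Finsupp.single i 1 +
          dihedralCoeff (Real.pi / M i j) (k + 1) • Finsupp.single j 1 := by
  induction k with
  | zero => simp [dihedralCoeff, CoxeterSystem.alternatingWord]
  | succ k ih =>
    rw [CoxeterSystem.alternatingWord_succ', List.map_cons, List.prod_cons, Module.End.mul_apply,
      ih]
    by_cases hk : Even k
    · have hk' : ¬ Even (k + 1) := by simpa [Nat.even_add_one] using hk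
      simp only [hk, hk', if_true, if_false, map_add, map_smul, simpleReflection_single_self]
      rw [simpleReflection_apply, rootForm_single, M.symmetric j i, dihedralCoeff]
      module
    · have hk' : Even (k + 1) := by simpa [Nat.even_add_one] using hk
      simp only [hk, hk', if_true, if_false, map_add, map_smul, simpleReflection_single_self]
      rw [simpleReflection_apply, rootForm_single, dihedralCoeff]
      module

theorem exists_nonneg_prod_alternatingWord {i j : A} (hij : i ≠ j) {k : ℕ}
    (hk : M i j = 0 ∨ k < M i j) :
    ∃ p q : ℝ, 0 ≤ p ∧ 0 ≤ q ∧
      ((CoxeterSystem.alternatingWord i j k).map M.simpleReflection).prod (Finsupp.single i 1) =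
        p • Finsupp.single i 1 + q • Finsupp.single j 1 := by
  have h0 := dihedralCoeff_nonneg (k := k) (M.off_diagonal i j hij) (by omega)
  have h1 := dihedralCoeff_nonneg (k := k + 1) (M.off_diagonal i j hij) (by omega)
  rw [prod_alternatingWord_apply_single]
  split_ifs
  · exact ⟨_, _, h1, h0, rfl⟩
  · exact ⟨_, _, h0, h1, rfl⟩

theorem prod_alternatingWord_two_mul {G : Type*} [Monoid G] (f : A → G) (i j : A) (k : ℕ) :
    ((CoxeterSystem.alternatingWord i j (2 * k)).map f).prod = (f i * f j) ^ k := by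
  induction k with
  | zero => simp [CoxeterSystem.alternatingWord]
  | succ k ih =>
    rw [show 2 * (k + 1) = 2 * k + 1 + 1 by ring, CoxeterSystem.alternatingWord_succ',
      CoxeterSystem.alternatingWord_succ', List.map_cons, List.map_cons, List.prod_cons,
      List.prod_cons, ih, pow_succ']
    simp [mul_assoc]

theorem simpleReflection_mul_pow_apply_single {i j : A} (hij : i ≠ j) (hM : M i j ≠ 0) :
    ((M.simpleReflection i * M.simpleReflection j) ^ M i j) (Finsupp.single i 1) =
      Finsupp.single i 1 := by
  have hm : 2 ≤ M i j := by have := M.off_diagonal i j hij; omega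
  have hs := sin_pi_div_pos hm
  have hm0 : (M i j : ℝ) ≠ 0 := by exact_mod_cast hM
  have e : ((2 * M i j : ℕ) : ℝ) * (Real.pi / M i j) = 2 * Real.pi := by
    push_cast; field_simp
  have e' : ((2 * M i j + 1 : ℕ) : ℝ) * (Real.pi / M i j) = Real.pi / M i j + 2 * Real.pi := by
    rw [← e]; push_cast; ring
  have h0 : dihedralCoeff (Real.pi / M i j) (2 * M i j) = 0 := by
    have := dihedralCoeff_mul_sin (Real.pi / M i j) (2 * M i j)
    rw [e, Real.sin_two_pi] at this
    exact (mul_eq_zero.1 this).resolve_right hs.ne'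
  have h1 : dihedralCoeff (Real.pi / M i j) (2 * M i j + 1) = 1 := by
    have := dihedralCoeff_mul_sin (Real.pi / M i j) (2 * M i j + 1)
    rw [e', Real.sin_add_two_pi] at this
    exact mul_right_cancel₀ hs.ne' (this.trans (one_mul _).symm)
  rw [← prod_alternatingWord_two_mul, prod_alternatingWord_apply_single, h0, h1]
  simp

theorem isLiftable_simpleReflection : M.IsLiftable M.simpleReflection := by
  intro i j
  rcases eq_or_ne i j with rfl | hij
  · simp [simpleReflection_mul_self]
  rcases eq_or_ne (M i j) 0 with h0 | hM
  · simp [h0]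
  have hm : 2 ≤ M i j := by have := M.off_diagonal i j hij; omega
  have hs := sin_pi_div_pos hm
  set R := M.simpleReflection i * M.simpleReflection j with hR
  have hi : (R ^ M i j) (Finsupp.single i 1) = Finsupp.single i 1 :=
    M.simpleReflection_mul_pow_apply_single hij hM
  have hj : (R ^ M i j) (Finsupp.single j 1) = Finsupp.single j 1 := by
    -- The reverse product is the inverse of `R`, and its power fixes `αⱼ` by symmetry.
    have h := M.simpleReflection_mul_pow_apply_single hij.symm (by rwa [M.symmetric])
    rw [M.symmetric j i] at h
    have hinv : R * (M.simpleReflection j * M.simpleReflection i) = 1 := by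
      rw [hR, mul_assoc, ← mul_assoc (M.simpleReflection j), simpleReflection_mul_self, one_mul,
        simpleReflection_mul_self]
    have hinv' : (M.simpleReflection j * M.simpleReflection i) * R = 1 := by
      rw [hR, mul_assoc, ← mul_assoc (M.simpleReflection i), simpleReflection_mul_self, one_mul,
        simpleReflection_mul_self]
    have hcomm : Commute R (M.simpleReflection j * M.simpleReflection i) := hinv.trans hinv'.symm
    have hpow := hcomm.mul_pow (M i j)
    rw [hinv, one_pow] at hpow
    have h2 := congrArg (fun f : Module.End ℝ (A →₀ ℝ) => f (Finsupp.single j 1)) hpow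
    simp only [Module.End.mul_apply, h, Module.End.one_apply] at h2
    exact h2.symm
  -- The vector `z` splits into a part in the span of `αᵢ`, `αⱼ`, on which the form is
  -- nondegenerate because `sin (π / M i j) ≠ 0`, and a part fixed by both reflections.
  refine LinearMap.ext fun z => ?_
  set c := Real.cos (Real.pi / M i j) with hc
  set σ := Real.sin (Real.pi / M i j) with hσ
  have hsc : σ ^ 2 + c ^ 2 = 1 := Real.sin_sq_add_cos_sq _
  have hs2 : 2 * σ ^ 2 ≠ 0 := by positivity
  set p := (M.rootForm i z + c * M.rootForm j z) / (2 * σ ^ 2) with hp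
  set q := (M.rootForm j z + c * M.rootForm i z) / (2 * σ ^ 2) with hq
  have hpe : p * (2 * σ ^ 2) = M.rootForm i z + c * M.rootForm j z := div_mul_cancel₀ _ hs2
  have hqe : q * (2 * σ ^ 2) = M.rootForm j z + c * M.rootForm i z := div_mul_cancel₀ _ hs2
  set z' := z - p • Finsupp.single i 1 - q • Finsupp.single j 1 with hz'
  have hzi : M.rootForm i z' = 0 := by
    rw [hz', map_sub, map_sub, map_smul, map_smul, rootForm_single_self, rootForm_single,
      smul_eq_mul, smul_eq_mul, ← hc]
    apply mul_right_cancel₀ hs2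
    linear_combination (-2) * hpe + 2 * c * hqe + 2 * M.rootForm i z * hsc
  have hzj : M.rootForm j z' = 0 := by
    rw [hz', map_sub, map_sub, map_smul, map_smul, rootForm_single_self, rootForm_single,
      smul_eq_mul, smul_eq_mul, M.symmetric j i, ← hc]
    apply mul_right_cancel₀ hs2
    linear_combination (-2) * hqe + 2 * c * hpe + 2 * M.rootForm j z * hsc
  have hfix : ∀ k : ℕ, (R ^ k) z' = z' := by
    intro k
    induction k with
    | zero => simp
    | succ k ih =>
      rw [pow_succ, Module.End.mul_apply, hR, Module.End.mul_apply,
        M.simpleReflection_of_rootForm_eq_zero hzj, M.simpleReflection_of_rootForm_eq_zero hzi,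
        ← hR, ih]
  have hz : z = z' + p • Finsupp.single i 1 + q • Finsupp.single j 1 := by rw [hz']; abel
  rw [Module.End.one_apply]
  conv_lhs => rw [hz]
  rw [map_add, map_add, map_smul, map_smul, hi, hj, hfix, ← hz]

end CoxeterMatrix

/-! ### Lengths and descents in a Coxeter group -/

namespace CoxeterSystem

variable {A W : Type*} [Group W] {M : CoxeterMatrix A} (cs : CoxeterSystem M W)

/-- The geometric representation of a Coxeter group. -/
noncomputable def geomRep : W →* Module.End ℝ (A →₀ ℝ) :=
  cs.lift ⟨M.simpleReflection, M.isLiftable_simpleReflection⟩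

theorem geomRep_simple (i : A) : cs.geomRep (cs.simple i) = M.simpleReflection i :=
  cs.lift_apply_simple _ i

theorem geomRep_wordProd (ω : List A) :
    cs.geomRep (cs.wordProd ω) = (ω.map M.simpleReflection).prod := by
  induction ω with
  | nil => simp
  | cons i ω ih => rw [wordProd_cons, map_mul, geomRep_simple, ih, List.map_cons, List.prod_cons]

theorem geomRep_mul_simple (w : W) (i : A) :
    cs.geomRep (w * cs.simple i) (Finsupp.single i 1) =
      -cs.geomRep w (Finsupp.single i 1) := by
  rw [map_mul, geomRep_simple, Module.End.mul_apply, M.simpleReflection_single_self, map_neg]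

theorem geomRep_single_ne_zero (w : W) (i : A) : cs.geomRep w (Finsupp.single i 1) ≠ 0 := by
  intro h
  have h1 : cs.geomRep (w⁻¹ * w) (Finsupp.single i 1) = 0 := by
    rw [map_mul, Module.End.mul_apply, h, map_zero]
  simp at h1

/-- The alternating word of length `k + 1` begins with `i` or with `j`, depending on parity. -/
theorem wordProd_alternatingWord_succ (i j : A) (k : ℕ) :
    cs.wordProd (alternatingWord i j (k + 1)) =
      cs.simple (if Even k then j else i) * cs.wordProd (alternatingWord i j k) := by
  rw [alternatingWord_succ', wordProd_cons]

theorem wordProd_alternatingWord_succ_right (i j : A) (k : ℕ) :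
    cs.wordProd (alternatingWord i j (k + 1)) =
      cs.wordProd (alternatingWord j i k) * cs.simple j := by
  rw [alternatingWord_succ, wordProd_concat]

/-- If `s` is not a right descent of `w`, then `w` sends the simple root `α_s` to a nonnegative
combination of simple roots.  By induction on the length of `w`: for a right descent `t` of `w`,
split off from `w` the longest possible right factor in the dihedral subgroup generated by `s`
and `t`. -/
theorem geomRep_nonneg_of_not_isRightDescent (w : W) (s : A) (hs : ¬ cs.IsRightDescent w s) :
    0 ≤ cs.geomRep w (Finsupp.single s 1) := by
  induction hn : cs.length w using Nat.strong_induction_on generalizing w s with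
  | _ n ih =>
  subst hn
  rcases eq_or_ne w 1 with rfl | hw
  · simp
  obtain ⟨t, ht⟩ := cs.exists_rightDescent_of_ne_one hw
  have hst : s ≠ t := by rintro rfl; exact hs ht
  let u : ℕ → W := fun k => cs.wordProd (alternatingWord s t k)
  have hu : ∀ k, u (k + 1) = cs.simple (if Even k then t else s) * u k := fun k =>
    cs.wordProd_alternatingWord_succ s t k
  obtain ⟨k, hk, hk'⟩ : ∃ k, cs.length (w * (u (k + 1))⁻¹) + (k + 1) = cs.length w ∧
      ¬ cs.length (w * (u (k + 2))⁻¹) + (k + 2) = cs.length w := by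
    by_contra! hcon
    have hall : ∀ k, cs.length (w * (u (k + 1))⁻¹) + (k + 1) = cs.length w := by
      intro k
      induction k with
      | zero =>
        rw [isRightDescent_iff] at ht
        simpa [u, alternatingWord] using ht
      | succ k ihk => exact hcon k ihk
    have := hall (cs.length w)
    omega
  set v := w * (u (k + 1))⁻¹ with hv
  have hwv : w = v * u (k + 1) := by simp [hv]
  have hd1 : ¬ cs.IsRightDescent v (if Even (k + 1) then t else s) := by
    rw [isRightDescent_iff]
    intro h
    apply hk'
    rw [show k + 2 = k + 1 + 1 from rfl, hu (k + 1), mul_inv_rev, inv_simple, ← mul_assoc, ← hv]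
    omega
  have hd2 : ¬ cs.IsRightDescent v (if Even k then t else s) := by
    rw [isRightDescent_iff]
    intro h
    have h1 : v * cs.simple (if Even k then t else s) * u k = w := by
      rw [mul_assoc, ← hu, ← hwv]
    have h2 := cs.length_mul_le (v * cs.simple (if Even k then t else s)) (u k)
    rw [h1] at h2
    have h3 := cs.length_wordProd_le (alternatingWord s t k)
    rw [length_alternatingWord] at h3
    change cs.length (u k) ≤ k at h3
    omega
  have hds : ¬ cs.IsRightDescent v s ∧ ¬ cs.IsRightDescent v t := by
    by_cases hp : Even k
    · have hp' : ¬ Even (k + 1) := by simpa [Nat.even_add_one] using hp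
      simp only [hp, hp', if_true, if_false] at hd1 hd2
      exact ⟨hd1, hd2⟩
    · have hp' : Even (k + 1) := by simpa [Nat.even_add_one] using hp
      simp only [hp, hp', if_true, if_false] at hd1 hd2
      exact ⟨hd2, hd1⟩
  have hlt : M s t = 0 ∨ k + 1 < M s t := by
    by_contra! hcon
    obtain ⟨hM, hle⟩ := hcon
    rcases hle.lt_or_eq with hlt | heq
    · apply cs.not_isReduced_alternatingWord s t hM hlt
      have h2 := cs.length_mul_le v (u (k + 1))
      rw [← hwv] at h2
      have h3 := cs.length_wordProd_le (alternatingWord s t (k + 1))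
      rw [IsReduced]
      rw [length_alternatingWord] at h3 ⊢
      change cs.length (u (k + 1)) ≤ k + 1 at h3
      change cs.length (u (k + 1)) = k + 1
      omega
    · -- The longest dihedral element also has a reduced word ending in `s`.
      have hb := cs.wordProd_braidWord_eq s t
      rw [braidWord, braidWord, M.symmetric t s, heq,
        cs.wordProd_alternatingWord_succ_right t s] at hb
      change u (k + 1) = u k * cs.simple s at hb
      apply hs
      rw [IsRightDescent]
      have h1 : w * cs.simple s = v * u k := by
        rw [hwv, hb]; simp [mul_assoc]
      have h2 := cs.length_mul_le v (u k)
      have h3 := cs.length_wordProd_le (alternatingWord s t k)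
      rw [length_alternatingWord] at h3
      change cs.length (u k) ≤ k at h3
      rw [h1]
      omega
  obtain ⟨p, q, hp, hq, hpq⟩ := M.exists_nonneg_prod_alternatingWord hst hlt
  rw [hwv, map_mul, Module.End.mul_apply]
  change 0 ≤ cs.geomRep v (cs.geomRep (cs.wordProd (alternatingWord s t (k + 1))) _)
  rw [geomRep_wordProd, hpq, map_add, map_smul, map_smul]
  exact add_nonneg (smul_nonneg hp (ih _ (by omega) v s hds.1 rfl))
    (smul_nonneg hq (ih _ (by omega) v t hds.2 rfl))

theorem geomRep_nonpos_of_isRightDescent {w : W} {s : A} (hs : cs.IsRightDescent w s) :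
    cs.geomRep w (Finsupp.single s 1) ≤ 0 := by
  have h := cs.geomRep_nonneg_of_not_isRightDescent (w * cs.simple s) s
    (cs.isRightDescent_iff_not_isRightDescent_mul.1 hs)
  rwa [geomRep_mul_simple, neg_nonneg] at h

theorem not_isRightDescent_of_geomRep_nonneg {w : W} {s : A}
    (h : 0 ≤ cs.geomRep w (Finsupp.single s 1)) : ¬ cs.IsRightDescent w s := fun hs =>
  cs.geomRep_single_ne_zero w s (le_antisymm (cs.geomRep_nonpos_of_isRightDescent hs) h)

theorem isRightDescent_of_geomRep_nonpos {w : W} {s : A}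
    (h : cs.geomRep w (Finsupp.single s 1) ≤ 0) : cs.IsRightDescent w s := by
  by_contra hs
  exact cs.geomRep_single_ne_zero w s
    (le_antisymm h (cs.geomRep_nonneg_of_not_isRightDescent w s hs))

theorem geomRep_mul_alternatingWord {i j : A} (hij : i ≠ j) {k : ℕ}
    (hk : M i j = 0 ∨ k < M i j) (w : W) :
    ∃ p q : ℝ, 0 ≤ p ∧ 0 ≤ q ∧
      cs.geomRep (w * cs.wordProd (alternatingWord i j k)) (Finsupp.single i 1) =
        p • cs.geomRep w (Finsupp.single i 1) + q • cs.geomRep w (Finsupp.single j 1) := by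
  obtain ⟨p, q, hp, hq, hpq⟩ := M.exists_nonneg_prod_alternatingWord hij hk
  exact ⟨p, q, hp, hq, by
    rw [map_mul, Module.End.mul_apply, geomRep_wordProd, hpq, map_add, map_smul, map_smul]⟩

/-- If neither `i` nor `j` is a right descent of `w`, then `w` is the shortest element of its left
coset of the dihedral subgroup generated by `i` and `j`. -/
theorem length_mul_alternatingWord_of_not_isRightDescent {w : W} {i j : A} (hij : i ≠ j)
    (hi : ¬ cs.IsRightDescent w i) (hj : ¬ cs.IsRightDescent w j) {k : ℕ}
    (hk : M i j = 0 ∨ k ≤ M i j) :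
    cs.length (w * cs.wordProd (alternatingWord i j k)) = cs.length w + k := by
  induction k generalizing i j with
  | zero => simp [alternatingWord]
  | succ k ih =>
    have hk' : M j i = 0 ∨ k < M j i := by rw [M.symmetric j i]; omega
    obtain ⟨p, q, hp, hq, hpq⟩ := cs.geomRep_mul_alternatingWord hij.symm hk' w
    have h : ¬ cs.IsRightDescent (w * cs.wordProd (alternatingWord j i k)) j := by
      apply cs.not_isRightDescent_of_geomRep_nonneg
      rw [hpq]
      exact add_nonneg (smul_nonneg hp (cs.geomRep_nonneg_of_not_isRightDescent w j hj))
        (smul_nonneg hq (cs.geomRep_nonneg_of_not_isRightDescent w i hi))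
    rw [not_isRightDescent_iff] at h
    rw [wordProd_alternatingWord_succ_right, ← mul_assoc, h,
      ih hij.symm hj hi (by omega)]
    omega

/-- If both `i` and `j` are right descents of `w`, then `w` is the longest element of its left
coset of the dihedral subgroup generated by `i` and `j`. -/
theorem length_mul_alternatingWord_of_isRightDescent {w : W} {i j : A} (hij : i ≠ j)
    (hi : cs.IsRightDescent w i) (hj : cs.IsRightDescent w j) {k : ℕ}
    (hk : M i j = 0 ∨ k ≤ M i j) :
    cs.length (w * cs.wordProd (alternatingWord i j k)) + k = cs.length w := by
  induction k generalizing i j with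
  | zero => simp [alternatingWord]
  | succ k ih =>
    have hk' : M j i = 0 ∨ k < M j i := by rw [M.symmetric j i]; omega
    obtain ⟨p, q, hp, hq, hpq⟩ := cs.geomRep_mul_alternatingWord hij.symm hk' w
    have h : cs.IsRightDescent (w * cs.wordProd (alternatingWord j i k)) j := by
      apply cs.isRightDescent_of_geomRep_nonpos
      rw [hpq]
      exact add_nonpos
        (smul_nonpos_of_nonneg_of_nonpos hp (cs.geomRep_nonpos_of_isRightDescent hj))
        (smul_nonpos_of_nonneg_of_nonpos hq (cs.geomRep_nonpos_of_isRightDescent hi))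
    rw [isRightDescent_iff] at h
    have h' := ih hij.symm hj hi (by omega)
    rw [wordProd_alternatingWord_succ_right, ← mul_assoc]
    omega

theorem coxeterMatrix_ne_zero_of_isRightDescent {w : W} {i j : A} (hij : i ≠ j)
    (hi : cs.IsRightDescent w i) (hj : cs.IsRightDescent w j) : M i j ≠ 0 := by
  intro h0
  have := cs.length_mul_alternatingWord_of_isRightDescent hij hi hj
    (k := cs.length w + 1) (Or.inl h0)
  omega

theorem isReduced_alternatingWord {i j : A} (hij : i ≠ j) {k : ℕ}
    (hk : M i j = 0 ∨ k ≤ M i j) : cs.IsReduced (alternatingWord i j k) := by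
  have h := cs.length_mul_alternatingWord_of_not_isRightDescent hij
    (cs.not_isRightDescent_one i) (cs.not_isRightDescent_one j) hk
  rw [IsReduced, length_alternatingWord]
  simpa using h

/-- If every generator is a right descent of `w`, then `w` is the longest element of the
group. -/
theorem length_le_of_forall_isRightDescent {w : W} (hw : ∀ i, cs.IsRightDescent w i) (v : W) :
    cs.length v ≤ cs.length w := by
  -- The element `w` makes all roots negative, so lengthening `v` shortens `w * v`.
  have hneg : ∀ x : A →₀ ℝ, 0 ≤ x → cs.geomRep w x ≤ 0 := by
    intro x hx
    rw [← Finsupp.sum_single x, Finsupp.sum, map_sum]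
    refine Finset.sum_nonpos fun i _ => ?_
    rw [← mul_one (x i), ← smul_eq_mul, ← Finsupp.smul_single, map_smul]
    exact smul_nonpos_of_nonneg_of_nonpos (hx i) (cs.geomRep_nonpos_of_isRightDescent (hw i))
  have key : cs.length (w * v) + cs.length v = cs.length w := by
    induction hn : cs.length v generalizing v with
    | zero => rw [length_eq_zero_iff] at hn; simp [hn]
    | succ n ih =>
      obtain ⟨i, hi⟩ := cs.exists_rightDescent_of_ne_one (w := v)
        (by rintro rfl; simp at hn)
      have hi' := cs.isRightDescent_iff_not_isRightDescent_mul.1 hi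
      rw [isRightDescent_iff] at hi
      have h1 := ih (v * cs.simple i) (by omega)
      have h2 : cs.IsRightDescent (w * (v * cs.simple i)) i := by
        apply cs.isRightDescent_of_geomRep_nonpos
        rw [map_mul, Module.End.mul_apply]
        exact hneg _ (cs.geomRep_nonneg_of_not_isRightDescent _ i hi')
      rw [isRightDescent_iff] at h2
      simp only [mul_assoc, simple_mul_simple_self, mul_one] at h2 h1
      omega
  omega

end CoxeterSystem

/-! ### The weak order and greatest prefixes -/

namespace CoxeterSystem

variable {A W : Type*} [Group W] {M : CoxeterMatrix A} (cs : CoxeterSystem M W)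

/-- The product `x * y` is reduced: lengths add up. -/
def IsReducedMul (x y : W) : Prop := cs.length (x * y) = cs.length x + cs.length y

/-- The right weak order: `z` is a prefix of `w` if `w` is a reduced product `z * y`. -/
def IsPrefix (z w : W) : Prop := ∃ y, cs.IsReducedMul z y ∧ z * y = w

variable {cs}

theorem IsReducedMul.assoc_right {x y z : W} (h : cs.IsReducedMul x y)
    (h' : cs.IsReducedMul (x * y) z) : cs.IsReducedMul y z ∧ cs.IsReducedMul x (y * z) := by
  unfold IsReducedMul at *
  rw [mul_assoc] at h'
  have h1 := cs.length_mul_le y z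
  have h2 := cs.length_mul_le x (y * z)
  omega

theorem IsReducedMul.assoc_left {x y z : W} (h : cs.IsReducedMul y z)
    (h' : cs.IsReducedMul x (y * z)) : cs.IsReducedMul x y ∧ cs.IsReducedMul (x * y) z := by
  unfold IsReducedMul at *
  have h1 := cs.length_mul_le x y
  have h2 := cs.length_mul_le (x * y) z
  rw [mul_assoc] at h2 ⊢
  omega

theorem isReducedMul_one_left (x : W) : cs.IsReducedMul 1 x := by simp [IsReducedMul]

theorem isReducedMul_one_right (x : W) : cs.IsReducedMul x 1 := by simp [IsReducedMul]

theorem IsReducedMul.isPrefix {x y : W} (h : cs.IsReducedMul x y) : cs.IsPrefix x (x * y) :=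
  ⟨y, h, rfl⟩

theorem isPrefix_refl (w : W) : cs.IsPrefix w w := ⟨1, isReducedMul_one_right w, mul_one w⟩

theorem isPrefix_one_left (w : W) : cs.IsPrefix 1 w := ⟨w, isReducedMul_one_left w, one_mul w⟩

theorem IsPrefix.trans {x y z : W} (h : cs.IsPrefix x y) (h' : cs.IsPrefix y z) :
    cs.IsPrefix x z := by
  obtain ⟨u, hu, rfl⟩ := h
  obtain ⟨v, hv, rfl⟩ := h'
  exact ⟨u * v, (hu.assoc_right hv).2, (mul_assoc _ _ _).symm⟩

theorem IsPrefix.length_le {x y : W} (h : cs.IsPrefix x y) : cs.length x ≤ cs.length y := by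
  obtain ⟨u, hu, rfl⟩ := h
  exact hu ▸ Nat.le_add_right _ _

theorem IsPrefix.antisymm {x y : W} (h : cs.IsPrefix x y) (h' : cs.IsPrefix y x) : x = y := by
  have hle := h'.length_le
  obtain ⟨u, hu, rfl⟩ := h
  unfold IsReducedMul at hu
  have : u = 1 := cs.length_eq_zero_iff.1 (by omega)
  rw [this, mul_one]

theorem IsPrefix.isReducedMul {x z w : W} (h : cs.IsPrefix z w) (hx : cs.IsReducedMul x w) :
    cs.IsReducedMul x z := by
  obtain ⟨u, hu, rfl⟩ := h
  exact (hu.assoc_left hx).1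

theorem IsPrefix.mul_left {x z w : W} (h : cs.IsPrefix z w) (hx : cs.IsReducedMul x w) :
    cs.IsPrefix (x * z) (x * w) := by
  obtain ⟨u, hu, rfl⟩ := h
  exact ⟨u, (hu.assoc_left hx).2, mul_assoc _ _ _⟩

theorem IsPrefix.of_mul_left {x z w : W} (h : cs.IsPrefix (x * z) (x * w))
    (hz : cs.IsReducedMul x z) : cs.IsPrefix z w := by
  obtain ⟨u, hu, he⟩ := h
  rw [mul_assoc] at he
  exact ⟨u, (hz.assoc_right hu).1, mul_left_cancel he⟩

theorem isLeftDescent_iff_isPrefix {w : W} {i : A} :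
    cs.IsLeftDescent w i ↔ cs.IsPrefix (cs.simple i) w := by
  rw [isLeftDescent_iff]
  constructor
  · intro h
    refine ⟨cs.simple i * w, ?_, by simp⟩
    rw [IsReducedMul, simple_mul_simple_cancel_left, length_simple]
    omega
  · rintro ⟨y, hy, rfl⟩
    rw [simple_mul_simple_cancel_left, hy, length_simple]
    omega

theorem isReducedMul_simple_right_iff {w : W} {i : A} :
    cs.IsReducedMul w (cs.simple i) ↔ ¬ cs.IsRightDescent w i := by
  rw [not_isRightDescent_iff, IsReducedMul, length_simple]

theorem IsReduced.isReducedMul_cons {i : A} {ω : List A} (h : cs.IsReduced (i :: ω)) :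
    cs.IsReducedMul (cs.simple i) (cs.wordProd ω) := by
  have h' : cs.IsReduced ω := by simpa using h.drop 1
  unfold IsReduced at h h'
  rw [IsReducedMul, ← wordProd_cons, h, h', length_simple, List.length_cons, add_comm]

variable (cs)

theorem length_wordProd_braidWord {i j : A} (hij : i ≠ j) :
    cs.length (cs.wordProd (braidWord M i j)) = M i j := by
  rw [cs.isReduced_alternatingWord hij (Or.inr le_rfl), length_alternatingWord]

/-- The longest element of a dihedral parabolic subgroup is a prefix of every element that has
both generators as left descents. -/
theorem isPrefix_braidWord {w : W} {i j : A} (hij : i ≠ j) (hi : cs.IsLeftDescent w i)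
    (hj : cs.IsLeftDescent w j) :
    M i j ≠ 0 ∧ cs.IsPrefix (cs.wordProd (braidWord M i j)) w := by
  rw [← isRightDescent_inv_iff] at hi hj
  refine ⟨cs.coxeterMatrix_ne_zero_of_isRightDescent hij hi hj,
    (cs.wordProd (braidWord M i j))⁻¹ * w, ?_, by simp⟩
  have h := cs.length_mul_alternatingWord_of_isRightDescent hij hi hj (Or.inr le_rfl)
  rw [← length_inv, mul_inv_rev, inv_inv, length_inv] at h
  rw [IsReducedMul, mul_inv_cancel_left, cs.length_wordProd_braidWord hij, ← h, add_comm]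

/-- The braid word in `i`, `j` begins with `i` or with `j`, depending on the parity of its length. -/
theorem isLeftDescent_braidWord_ite {i j : A} (hij : i ≠ j) (hM : M i j ≠ 0) :
    cs.IsLeftDescent (cs.wordProd (braidWord M i j)) (if Even (M i j) then i else j) := by
  obtain ⟨k, hk⟩ := Nat.exists_eq_succ_of_ne_zero hM
  have hl := cs.length_wordProd_braidWord hij
  rw [IsLeftDescent, hl, braidWord, hk, wordProd_alternatingWord_succ]
  have hp : (if Even k then j else i) = if Even (k + 1) then i else j := by
    by_cases h : Even k <;> simp [h, Nat.even_add_one]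
  rw [hp, simple_mul_simple_cancel_left]
  have := cs.length_wordProd_le (alternatingWord i j k)
  rw [length_alternatingWord] at this
  omega

theorem isLeftDescent_braidWord {i j : A} (hij : i ≠ j) (hM : M i j ≠ 0) :
    cs.IsLeftDescent (cs.wordProd (braidWord M i j)) i := by
  have h1 := cs.isLeftDescent_braidWord_ite hij hM
  have h2 := cs.isLeftDescent_braidWord_ite hij.symm (by rwa [M.symmetric])
  rw [← cs.wordProd_braidWord_eq i j, M.symmetric j i] at h2
  by_cases h : Even (M i j)
  · simpa [h] using h1
  · simpa [h] using h2

/-- The prefixes `z` of `w` for which `x * z` is reduced have the greatest element `z`. -/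
def IsGreatestPrefix (x w z : W) : Prop :=
  cs.IsPrefix z w ∧ cs.IsReducedMul x z ∧
    ∀ z', cs.IsPrefix z' w → cs.IsReducedMul x z' → cs.IsPrefix z' z

variable {cs} in
theorem IsGreatestPrefix.unique {x w z z' : W} (h : cs.IsGreatestPrefix x w z)
    (h' : cs.IsGreatestPrefix x w z') : z = z' :=
  (h'.2.2 _ h.1 h.2.1).antisymm (h.2.2 _ h'.1 h'.2.1)

/-- Local confluence: two one-letter extensions of `z` among the prefixes of `w` without left
descent `i` have a common extension of the same kind. -/
theorem exists_common_extension {w z : W} {i a b : A} (hab : a ≠ b)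
    (hza : cs.IsReducedMul z (cs.simple a)) (hzb : cs.IsReducedMul z (cs.simple b))
    (hwa : cs.IsPrefix (z * cs.simple a) w) (hwb : cs.IsPrefix (z * cs.simple b) w)
    (hia : cs.IsReducedMul (cs.simple i) (z * cs.simple a))
    (hib : cs.IsReducedMul (cs.simple i) (z * cs.simple b)) :
    ∃ d, cs.IsPrefix d w ∧ cs.IsReducedMul (cs.simple i) d ∧ cs.IsPrefix (z * cs.simple a) d ∧
      cs.IsPrefix (z * cs.simple b) d := by
  obtain ⟨y, hy, rfl⟩ := hza.isPrefix.trans hwa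
  have hda := isLeftDescent_iff_isPrefix.2 (hwa.of_mul_left hza)
  have hdb := isLeftDescent_iff_isPrefix.2 (hwb.of_mul_left hzb)
  obtain ⟨hM, hΔ⟩ := cs.isPrefix_braidWord hab hda hdb
  have hzΔ := hΔ.isReducedMul hy
  refine ⟨z * cs.wordProd (braidWord M a b), hΔ.mul_left hy, ?_, ?_, ?_⟩
  · obtain ⟨h1, h2⟩ := hza.assoc_left hia
    obtain ⟨-, h3⟩ := hzb.assoc_left hib
    rw [isReducedMul_simple_right_iff] at h2 h3
    have h4 := cs.length_mul_alternatingWord_of_not_isRightDescent hab h2 h3 (Or.inr le_rfl)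
    have h5 := cs.length_wordProd_braidWord hab
    unfold IsReducedMul at h1 hzΔ ⊢
    rw [hzΔ, h5, ← mul_assoc, h4, h1, add_assoc]
  · exact (isLeftDescent_iff_isPrefix.1 (cs.isLeftDescent_braidWord hab hM)).mul_left hzΔ
  · rw [cs.wordProd_braidWord_eq] at hzΔ ⊢
    exact (isLeftDescent_iff_isPrefix.1
      (cs.isLeftDescent_braidWord hab.symm (by rwa [M.symmetric]))).mul_left hzΔ

/-- Newman's lemma for the prefixes of `w` without left descent `i`: local confluence yields a
greatest one above each of them.  The induction is on the difference `n` of lengths. -/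
theorem exists_greatest_above (w : W) (i : A) (n : ℕ) (z : W) (hn : cs.length w - cs.length z = n)
    (hz : cs.IsPrefix z w) (hiz : cs.IsReducedMul (cs.simple i) z) :
    ∃ g, cs.IsPrefix g w ∧ cs.IsReducedMul (cs.simple i) g ∧
      ∀ z', cs.IsPrefix z' w → cs.IsReducedMul (cs.simple i) z' → cs.IsPrefix z z' →
        cs.IsPrefix z' g := by
  induction n using Nat.strong_induction_on generalizing z with
  | _ n ih =>
  -- A proper extension of `z` of the required kind contains a one-letter extension.
  have hstep : ∀ z', cs.IsPrefix z' w → cs.IsReducedMul (cs.simple i) z' → cs.IsPrefix z z' →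
      z' ≠ z → ∃ b, cs.IsReducedMul z (cs.simple b) ∧ cs.IsPrefix (z * cs.simple b) z' := by
    rintro _ - - ⟨y, hy, rfl⟩ hne
    obtain ⟨b, hb⟩ := cs.exists_leftDescent_of_ne_one (w := y) (by rintro rfl; simp at hne)
    rw [isLeftDescent_iff_isPrefix] at hb
    exact ⟨b, hb.isReducedMul hy, hb.mul_left hy⟩
  by_cases hex : ∃ a, cs.IsReducedMul z (cs.simple a) ∧ cs.IsPrefix (z * cs.simple a) w ∧
      cs.IsReducedMul (cs.simple i) (z * cs.simple a)
  · have hlen : ∀ d a, cs.IsReducedMul z (cs.simple a) → cs.IsPrefix (z * cs.simple a) d →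
        cs.IsPrefix d w → cs.length w - cs.length d < n := by
      intro d a ha had hd
      have h1 := had.length_le
      have h2 := hd.length_le
      rw [ha, length_simple] at h1
      omega
    obtain ⟨a, hza, hwa, hia⟩ := hex
    obtain ⟨ga, hga, higa, hmax⟩ :=
      ih _ (hlen _ a hza (isPrefix_refl _) hwa) (z * cs.simple a) rfl hwa hia
    refine ⟨ga, hga, higa, fun z' hz' hiz' hzz' => ?_⟩
    rcases eq_or_ne z' z with rfl | hne
    · exact hza.isPrefix.trans (hmax _ hwa hia (isPrefix_refl _))
    obtain ⟨b, hzb, hbz'⟩ := hstep z' hz' hiz' hzz' hne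
    rcases eq_or_ne a b with rfl | hab
    · exact hmax _ hz' hiz' hbz'
    have hwb := hbz'.trans hz'
    have hib := hbz'.isReducedMul hiz'
    obtain ⟨gb, hgb, higb, hmaxb⟩ :=
      ih _ (hlen _ b hzb (isPrefix_refl _) hwb) (z * cs.simple b) rfl hwb hib
    obtain ⟨d, hd, hid, had, hbd⟩ := cs.exists_common_extension hab hza hzb hwa hwb hia hib
    obtain ⟨gd, hgd, higd, hmaxd⟩ := ih _ (hlen _ a hza had hd) d rfl hd hid
    exact (hmaxb _ hz' hiz' hbz').trans ((hmaxd _ hgb higb (hmaxb _ hd hid hbd)).trans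
      (hmax _ hgd higd (had.trans (hmaxd _ hd hid (isPrefix_refl _)))))
  · refine ⟨z, hz, hiz, fun z' hz' hiz' hzz' => ?_⟩
    rcases eq_or_ne z' z with rfl | hne
    · exact isPrefix_refl _
    obtain ⟨b, hzb, hbz'⟩ := hstep z' hz' hiz' hzz' hne
    exact absurd ⟨b, hzb, hbz'.trans hz', hbz'.isReducedMul hiz'⟩ hex

theorem exists_isGreatestPrefix_simple (i : A) (w : W) :
    ∃ z, cs.IsGreatestPrefix (cs.simple i) w z := by
  obtain ⟨g, h1, h2, h3⟩ := cs.exists_greatest_above w i _ 1 rfl (isPrefix_one_left w)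
    (isReducedMul_one_right _)
  exact ⟨g, h1, h2, fun z' hz' hiz' => h3 z' hz' hiz' (isPrefix_one_left _)⟩

/-- The greatest prefix of `w` that does not have `i` as a left descent. -/
noncomputable def greatestPrefix (i : A) (w : W) : W :=
  (cs.exists_isGreatestPrefix_simple i w).choose

theorem greatestPrefix_spec (i : A) (w : W) :
    cs.IsGreatestPrefix (cs.simple i) w (cs.greatestPrefix i w) :=
  (cs.exists_isGreatestPrefix_simple i w).choose_spec

variable {cs} in
theorem IsGreatestPrefix.comp {x w z v : W} {i : A} (hz : cs.IsGreatestPrefix x w z)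
    (hx : cs.IsReducedMul (cs.simple i) x)
    (hv : cs.IsGreatestPrefix (cs.simple i) (x * z) v) :
    ∃ v', v = x * v' ∧ cs.IsPrefix v' z ∧ cs.IsGreatestPrefix (cs.simple i * x) w v' := by
  obtain ⟨hzw, hxz, hmax⟩ := hz
  obtain ⟨hvx, hiv, hvmax⟩ := hv
  obtain ⟨v', hxv', rfl⟩ := hvmax x hxz.isPrefix hx
  have hv'z := hvx.of_mul_left hxv'
  refine ⟨v', rfl, hv'z, hv'z.trans hzw, (hxv'.assoc_left hiv).2, fun u hu hxu => ?_⟩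
  obtain ⟨hxu', hiu⟩ := hx.assoc_right hxu
  exact (hvmax _ ((hmax u hu hxu').mul_left hxz) hiu).of_mul_left hxu'

end CoxeterSystem

/-! ### Words and length in Artin-Tits monoids -/

namespace CoxeterMatrix

variable {A : Type*} (M : CoxeterMatrix A)

/-- The element of the Artin-Tits monoid represented by a word. -/
def atomProd (ω : List A) : M.ArtinTitsMonoid :=
  PresentedMonoid.mk M.ArtinTitsRel (FreeMonoid.ofList ω)

theorem atomProd_nil : M.atomProd [] = 1 := rfl

theorem atomProd_cons (a : A) (ω : List A) :
    M.atomProd (a :: ω) = M.atom a * M.atomProd ω := rfl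

theorem atomProd_append (ω ω' : List A) :
    M.atomProd (ω ++ ω') = M.atomProd ω * M.atomProd ω' := by
  rw [atomProd, FreeMonoid.ofList_append, map_mul]; rfl

theorem atomProd_braidWord (a b : A) :
    M.atomProd (CoxeterSystem.braidWord M a b) = M.atomProd (CoxeterSystem.braidWord M b a) :=
  PresentedMonoid.mk_eq_mk_of_rel ⟨a, b, rfl, rfl⟩

theorem atomProd_surjective : Function.Surjective M.atomProd := by
  intro x
  obtain ⟨u, rfl⟩ := PresentedMonoid.surjective_mk x
  exact ⟨u.toList, rfl⟩

@[elab_as_elim]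
theorem atom_mul_induction {p : M.ArtinTitsMonoid → Prop} (one : p 1)
    (atom_mul : ∀ a x, p x → p (M.atom a * x)) (x : M.ArtinTitsMonoid) : p x := by
  obtain ⟨ω, rfl⟩ := M.atomProd_surjective x
  induction ω with
  | nil => exact one
  | cons a ω ih => exact atom_mul a _ ih

theorem exists_eq_atom_mul {x : M.ArtinTitsMonoid} (hx : x ≠ 1) : ∃ a y, x = M.atom a * y := by
  induction x using M.atom_mul_induction with
  | one => exact absurd rfl hx
  | atom_mul a y _ => exact ⟨a, y, rfl⟩

theorem exists_eq_mul_atom {x : M.ArtinTitsMonoid} (hx : x ≠ 1) : ∃ a y, x = y * M.atom a := by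
  obtain ⟨ω, rfl⟩ := M.atomProd_surjective x
  rcases List.eq_nil_or_concat ω with rfl | ⟨ω', a, rfl⟩
  · exact absurd M.atomProd_nil hx
  · exact ⟨a, M.atomProd ω', by
      rw [List.concat_eq_append, atomProd_append, atomProd_cons, atomProd_nil, mul_one]⟩

/-- A family of elements of a monoid that satisfies the braid relations extends to the Artin-Tits
monoid. -/
def artinTitsLift {N : Type*} [Monoid N] (f : A → N)
    (hf : ∀ a b, ((CoxeterSystem.braidWord M a b).map f).prod =
      ((CoxeterSystem.braidWord M b a).map f).prod) : M.ArtinTitsMonoid →* N :=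
  PresentedMonoid.lift f (by
    rintro _ _ ⟨a, b, rfl, rfl⟩
    simpa [FreeMonoid.lift_apply] using hf a b)

/-- The word length on the Artin-Tits monoid, as a homomorphism. -/
def lengthHom : M.ArtinTitsMonoid →* Multiplicative ℕ :=
  M.artinTitsLift (fun _ => Multiplicative.ofAdd 1) fun a b => by
    simp [CoxeterSystem.braidWord, M.symmetric b a]

/-- The word length on the Artin-Tits monoid. -/
def len (x : M.ArtinTitsMonoid) : ℕ := (M.lengthHom x).toAdd

theorem len_one : M.len 1 = 0 := by simp [len]

theorem len_mul (x y : M.ArtinTitsMonoid) : M.len (x * y) = M.len x + M.len y := by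
  simp [len]

theorem len_atom (a : A) : M.len (M.atom a) = 1 := rfl

theorem len_atomProd (ω : List A) : M.len (M.atomProd ω) = ω.length := by
  induction ω with
  | nil => exact M.len_one
  | cons a ω ih => rw [atomProd_cons, len_mul, ih, len_atom, List.length_cons, add_comm]

theorem len_eq_zero {x : M.ArtinTitsMonoid} (hx : M.len x = 0) : x = 1 := by
  by_contra h
  obtain ⟨a, y, rfl⟩ := M.exists_eq_atom_mul h
  rw [len_mul, len_atom] at hx
  omega

theorem eq_one_of_isUnit {x : M.ArtinTitsMonoid} (hx : IsUnit x) : x = 1 := by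
  obtain ⟨y, hy⟩ := hx.exists_right_inv
  apply M.len_eq_zero
  have := M.len_mul x y
  rw [hy, len_one] at this
  omega

theorem not_isUnit_atom (a : A) : ¬ IsUnit (M.atom a) := fun h => by
  have := M.len_atom a
  rw [M.eq_one_of_isUnit h, len_one] at this
  omega

variable {M} in
theorem len_le_of_dvd {x y : M.ArtinTitsMonoid} (h : x ∣ y) : M.len x ≤ M.len y := by
  obtain ⟨c, rfl⟩ := h
  rw [len_mul]; omega

variable {M} in
theorem eq_of_dvd_of_len_le {x y : M.ArtinTitsMonoid} (h : x ∣ y) (hl : M.len y ≤ M.len x) :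
    x = y := by
  obtain ⟨c, rfl⟩ := h
  rw [len_mul] at hl
  rw [M.len_eq_zero (x := c) (by omega), mul_one]

/-- One of the two words of a braid relation begins with a prescribed letter. -/
theorem exists_braidWord_eq_cons (a b : A) {k : ℕ} (hk : M a b = k + 1) :
    ∃ c d, ((c = a ∧ d = b) ∨ (c = b ∧ d = a)) ∧
      CoxeterSystem.braidWord M c d = a :: CoxeterSystem.alternatingWord c d k := by
  by_cases hp : Even k
  · exact ⟨b, a, Or.inr ⟨rfl, rfl⟩, by
      rw [CoxeterSystem.braidWord, M.symmetric b a, hk, CoxeterSystem.alternatingWord_succ',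
        if_pos hp]⟩
  · exact ⟨a, b, Or.inl ⟨rfl, rfl⟩, by
      rw [CoxeterSystem.braidWord, hk, CoxeterSystem.alternatingWord_succ', if_neg hp]⟩

theorem exists_atomProd_braidWord_eq {a b : A} (hM : 3 ≤ M a b) :
    ∃ x, M.atomProd (CoxeterSystem.braidWord M a b) = M.atom a * (M.atom b * (M.atom a * x)) := by
  obtain ⟨k, hk⟩ : ∃ k, M a b = k + 3 := ⟨M a b - 3, by omega⟩
  by_cases hp : Even k
  · refine ⟨M.atomProd (CoxeterSystem.alternatingWord b a k), ?_⟩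
    rw [atomProd_braidWord, CoxeterSystem.braidWord, M.symmetric b a, hk,
      CoxeterSystem.alternatingWord_succ', CoxeterSystem.alternatingWord_succ',
      CoxeterSystem.alternatingWord_succ']
    simp only [Nat.even_add_one, hp, not_true_eq_false, not_false_eq_true, if_true, if_false,
      atomProd_cons]
  · refine ⟨M.atomProd (CoxeterSystem.alternatingWord a b k), ?_⟩
    rw [CoxeterSystem.braidWord, hk,
      CoxeterSystem.alternatingWord_succ', CoxeterSystem.alternatingWord_succ',
      CoxeterSystem.alternatingWord_succ']
    simp only [Nat.even_add_one, hp, not_true_eq_false, not_false_eq_true, if_true, if_false,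
      atomProd_cons]

end CoxeterMatrix

namespace CoxeterSystem

variable {A W : Type*} [Group W] {M : CoxeterMatrix A} (cs : CoxeterSystem M W)

/-! ### The section of the projection to the Coxeter group -/

/-- Reduced words of the same element of the Coxeter group represent the same element of the
Artin-Tits monoid (Matsumoto). -/
theorem atomProd_eq_of_isReduced {ω ω' : List A} (hω : cs.IsReduced ω) (hω' : cs.IsReduced ω')
    (h : cs.wordProd ω = cs.wordProd ω') : M.atomProd ω = M.atomProd ω' := by
  induction hn : ω.length generalizing ω ω' with
  | zero =>
    have hl : ω'.length = 0 := by rw [← hω', ← h, hω, hn]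
    rw [List.length_eq_zero_iff.1 hn, List.length_eq_zero_iff.1 hl]
  | succ n ih =>
    have hl : ω'.length = n + 1 := by rw [← hω', ← h, hω, hn]
    -- The case of words with a common first letter.
    have hcons : ∀ (a : A) (u v : List A), cs.IsReduced (a :: u) → cs.IsReduced (a :: v) →
        (a :: u).length = n + 1 → cs.wordProd (a :: u) = cs.wordProd (a :: v) →
        M.atomProd (a :: u) = M.atomProd (a :: v) := by
      intro a u v hu hv hlen he
      rw [wordProd_cons, wordProd_cons] at he
      rw [M.atomProd_cons, M.atomProd_cons,
        ih (by simpa using hu.drop 1) (by simpa using hv.drop 1) (mul_left_cancel he)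
          (by simpa using hlen)]
    cases ω with
    | nil => simp at hn
    | cons a u =>
    cases ω' with
    | nil => simp at hl
    | cons b v =>
    rcases eq_or_ne a b with rfl | hab
    · exact hcons a u v hω hω' hn h
    have hda : cs.IsPrefix (cs.simple a) (cs.wordProd (a :: u)) := by
      rw [wordProd_cons]; exact hω.isReducedMul_cons.isPrefix
    have hdb : cs.IsPrefix (cs.simple b) (cs.wordProd (a :: u)) := by
      rw [h, wordProd_cons]; exact hω'.isReducedMul_cons.isPrefix
    obtain ⟨hM, y, hy, he⟩ := cs.isPrefix_braidWord hab (isLeftDescent_iff_isPrefix.2 hda)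
      (isLeftDescent_iff_isPrefix.2 hdb)
    obtain ⟨ρ, hρ, rfl⟩ := cs.exists_isReduced y
    -- Insert between the two words a pair of words related by a braid relation at the front.
    have hbraid : ∀ c d : A, (c = a ∧ d = b) ∨ (c = b ∧ d = a) →
        cs.wordProd (braidWord M c d ++ ρ) = cs.wordProd (a :: u) ∧
        cs.IsReduced (braidWord M c d ++ ρ) ∧
        M.atomProd (braidWord M c d ++ ρ) = M.atomProd (braidWord M a b ++ ρ) := by
      intro c d hcd
      have e1 : cs.wordProd (braidWord M c d ++ ρ) = cs.wordProd (a :: u) := by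
        rw [wordProd_append, ← he]
        rcases hcd with ⟨rfl, rfl⟩ | ⟨rfl, rfl⟩
        · rfl
        · rw [cs.wordProd_braidWord_eq]
      refine ⟨e1, ?_, ?_⟩
      · have hMcd : M c d = M a b := by
          rcases hcd with ⟨rfl, rfl⟩ | ⟨rfl, rfl⟩
          · rfl
          · exact M.symmetric _ _
        rw [IsReduced, e1, ← he, hy, hρ.eq, cs.length_wordProd_braidWord hab, List.length_append,
          braidWord, length_alternatingWord, hMcd]
      · rw [M.atomProd_append, M.atomProd_append]
        rcases hcd with ⟨rfl, rfl⟩ | ⟨rfl, rfl⟩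
        · rfl
        · rw [M.atomProd_braidWord]
    obtain ⟨k, hk⟩ := Nat.exists_eq_succ_of_ne_zero hM
    obtain ⟨c, d, hcd, hβ⟩ := M.exists_braidWord_eq_cons a b hk
    obtain ⟨c', d', hcd', hβ'⟩ := M.exists_braidWord_eq_cons b a
      (show M b a = k + 1 by rw [M.symmetric, hk])
    obtain ⟨e1, r1, p1⟩ := hbraid c d hcd
    obtain ⟨e2, r2, p2⟩ := hbraid c' d' hcd'.symm
    rw [hβ] at e1 r1 p1
    rw [hβ'] at e2 r2 p2
    calc M.atomProd (a :: u) = _ := hcons a u _ hω r1 hn e1.symm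
      _ = _ := p1.trans p2.symm
      _ = M.atomProd (b :: v) :=
        (hcons b v _ hω' r2 hl (h.symm.trans e2.symm)).symm

/-- The element of the Artin-Tits monoid represented by the reduced words of `w`. -/
noncomputable def artinLift (w : W) : M.ArtinTitsMonoid :=
  M.atomProd (cs.exists_isReduced w).choose

variable {cs} in
theorem IsReduced.artinLift_wordProd {ω : List A} (hω : cs.IsReduced ω) :
    cs.artinLift (cs.wordProd ω) = M.atomProd ω :=
  cs.atomProd_eq_of_isReduced (cs.exists_isReduced _).choose_spec.1 hω
    (cs.exists_isReduced _).choose_spec.2.symm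

theorem artinLift_one : cs.artinLift 1 = 1 := by
  have h : cs.IsReduced [] := by simp [IsReduced]
  simpa [M.atomProd_nil] using h.artinLift_wordProd

theorem artinLift_simple (i : A) : cs.artinLift (cs.simple i) = M.atom i := by
  have h : cs.IsReduced [i] := by simp [IsReduced]
  simpa [M.atomProd_nil, M.atomProd_cons] using h.artinLift_wordProd

variable {cs} in
theorem IsReducedMul.artinLift_mul {x y : W} (h : cs.IsReducedMul x y) :
    cs.artinLift (x * y) = cs.artinLift x * cs.artinLift y := by
  obtain ⟨u, hu, rfl⟩ := cs.exists_isReduced x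
  obtain ⟨v, hv, rfl⟩ := cs.exists_isReduced y
  have huv : cs.IsReduced (u ++ v) := by
    rw [IsReduced, wordProd_append, h, hu.eq, hv.eq, List.length_append]
  rw [← wordProd_append, huv.artinLift_wordProd, hu.artinLift_wordProd, hv.artinLift_wordProd,
    M.atomProd_append]

variable {cs} in
theorem IsPrefix.artinLift_eq {z w : W} (h : cs.IsPrefix z w) :
    cs.artinLift w = cs.artinLift z * cs.artinLift (z⁻¹ * w) := by
  obtain ⟨y, hy, rfl⟩ := h
  rw [hy.artinLift_mul, inv_mul_cancel_left]

/-! ### Head and tail of an element of an Artin-Tits monoid -/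

/-- Left multiplication by an atom on pairs `(w, p)` standing for the product of the lift of `w`
with `p`: if `z` is the greatest prefix of `w` without left descent `i`, then `w = z * y` is
regrouped as `(sᵢ z) * y`. -/
noncomputable def headStep (i : A) : Function.End (W × M.ArtinTitsMonoid) := fun q =>
  (cs.simple i * cs.greatestPrefix i q.1,
    cs.artinLift ((cs.greatestPrefix i q.1)⁻¹ * q.1) * q.2)

/-- The composite of the regroupings along a reduced word depends only on the element of the
Coxeter group represented by the word. -/
theorem prod_map_headStep {ω : List A} (hω : cs.IsReduced ω) (w : W) (p : M.ArtinTitsMonoid) :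
    ∃ z, cs.IsGreatestPrefix (cs.wordProd ω) w z ∧
      (ω.map cs.headStep).prod (w, p) =
        (cs.wordProd ω * z, cs.artinLift (z⁻¹ * w) * p) := by
  induction ω with
  | nil =>
    refine ⟨w, ⟨isPrefix_refl w, ?_, fun _ h _ => h⟩, ?_⟩
    · rw [wordProd_nil]; exact isReducedMul_one_left w
    · simp [artinLift_one, Function.End.one_def]
  | cons i ω ih =>
    obtain ⟨z, hz, he⟩ := ih (by simpa using hω.drop 1)
    obtain ⟨v, hv, hvz, hgr⟩ := hz.comp hω.isReducedMul_cons (cs.greatestPrefix_spec i _)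
    rw [← wordProd_cons] at hgr
    refine ⟨v, hgr, ?_⟩
    rw [List.map_cons, List.prod_cons]
    change cs.headStep i ((ω.map cs.headStep).prod (w, p)) = _
    rw [he]
    simp only [headStep, hv, wordProd_cons, mul_assoc, Prod.mk.injEq, true_and]
    obtain ⟨y, hy, rfl⟩ := hvz
    obtain ⟨y', hy', rfl⟩ := hz.1
    rw [← mul_assoc]
    congr 1
    have := (hy.assoc_right hy').1.artinLift_mul
    simpa [mul_assoc] using this.symm

theorem prod_map_headStep_braidWord (a b : A) :
    ((braidWord M a b).map cs.headStep).prod = ((braidWord M b a).map cs.headStep).prod := by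
  rcases eq_or_ne a b with rfl | hab
  · rfl
  funext ⟨w, p⟩
  obtain ⟨z, hz, he⟩ := cs.prod_map_headStep
    (cs.isReduced_alternatingWord hab (k := M a b) (Or.inr le_rfl)) w p
  obtain ⟨z', hz', he'⟩ := cs.prod_map_headStep
    (cs.isReduced_alternatingWord hab.symm (k := M b a) (Or.inr le_rfl)) w p
  change cs.IsGreatestPrefix (cs.wordProd (braidWord M a b)) w z at hz
  change cs.IsGreatestPrefix (cs.wordProd (braidWord M b a)) w z' at hz'
  change ((braidWord M a b).map cs.headStep).prod (w, p) =
    (cs.wordProd (braidWord M a b) * z, _) at he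
  change ((braidWord M b a).map cs.headStep).prod (w, p) =
    (cs.wordProd (braidWord M b a) * z', _) at he'
  rw [cs.wordProd_braidWord_eq] at hz he
  rw [he, he', hz.unique hz']

/-- The action of the Artin-Tits monoid on pairs in which the atoms act by `headStep`. -/
noncomputable def headAction : M.ArtinTitsMonoid →* Function.End (W × M.ArtinTitsMonoid) :=
  M.artinTitsLift cs.headStep cs.prod_map_headStep_braidWord

/-- The pair formed by the head of `x`, the greatest element of the Coxeter group whose lift
divides `x`, and the complementary factor of `x`. -/
noncomputable def headTail (x : M.ArtinTitsMonoid) : W × M.ArtinTitsMonoid :=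
  cs.headAction x (1, 1)

theorem headTail_atom_mul (i : A) (x : M.ArtinTitsMonoid) :
    cs.headTail (M.atom i * x) = cs.headStep i (cs.headTail x) := by
  rw [headTail, map_mul]; rfl

theorem artinLift_simple_mul_greatestPrefix (i : A) (w : W) :
    cs.artinLift (cs.simple i * cs.greatestPrefix i w) =
      M.atom i * cs.artinLift (cs.greatestPrefix i w) := by
  rw [(cs.greatestPrefix_spec i w).2.1.artinLift_mul, artinLift_simple]

theorem artinLift_head_mul_tail (x : M.ArtinTitsMonoid) :
    cs.artinLift (cs.headTail x).1 * (cs.headTail x).2 = x := by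
  induction x using M.atom_mul_induction with
  | one => simp [headTail, artinLift_one, Function.End.one_def]
  | atom_mul i x ih =>
    rw [headTail_atom_mul]
    simp only [headStep]
    rw [artinLift_simple_mul_greatestPrefix, mul_assoc, ← mul_assoc (cs.artinLift _),
      ← (cs.greatestPrefix_spec i _).1.artinLift_eq, ih]

/-- Left cancellation: the head and tail of `a x` determine `x`. -/
theorem atom_mul_left_cancel (cs : CoxeterSystem M W) {i : A} {x y : M.ArtinTitsMonoid}
    (h : M.atom i * x = M.atom i * y) : x = y := by
  have key : ∀ x : M.ArtinTitsMonoid,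
      x = cs.artinLift (cs.simple i * (cs.headTail (M.atom i * x)).1) *
        (cs.headTail (M.atom i * x)).2 := by
    intro x
    rw [headTail_atom_mul]
    simp only [headStep, simple_mul_simple_cancel_left]
    rw [← mul_assoc, ← (cs.greatestPrefix_spec i _).1.artinLift_eq, artinLift_head_mul_tail]
  rw [key x, h, ← key y]

theorem atom_dvd_iff {i : A} {x : M.ArtinTitsMonoid} :
    M.atom i ∣ x ↔ cs.IsLeftDescent (cs.headTail x).1 i := by
  constructor
  · rintro ⟨y, rfl⟩
    rw [headTail_atom_mul, isLeftDescent_iff_isPrefix]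
    exact (cs.greatestPrefix_spec i _).2.1.isPrefix
  · intro h
    rw [← cs.artinLift_head_mul_tail x, (isLeftDescent_iff_isPrefix.1 h).artinLift_eq,
      artinLift_simple, mul_assoc]
    exact dvd_mul_right _ _

/-- Two distinct atoms with a common right multiple are related by a braid relation, and their
common right multiples are the right multiples of its two sides. -/
theorem braidWord_dvd (cs : CoxeterSystem M W) {a b : A} (hab : a ≠ b)
    {x : M.ArtinTitsMonoid} (ha : M.atom a ∣ x) (hb : M.atom b ∣ x) : M a b ≠ 0 ∧ M.atomProd (braidWord M a b) ∣ x := by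
  obtain ⟨hM, h⟩ := cs.isPrefix_braidWord hab (cs.atom_dvd_iff.1 ha) (cs.atom_dvd_iff.1 hb)
  refine ⟨hM, ?_⟩
  rw [← cs.artinLift_head_mul_tail x, h.artinLift_eq, mul_assoc,
    IsReduced.artinLift_wordProd (cs.isReduced_alternatingWord hab (Or.inr le_rfl))]
  exact dvd_mul_right _ _

theorem atom_injective (cs : CoxeterSystem M W) : Function.Injective M.atom := by
  intro a b h
  by_contra hab
  obtain ⟨hM, hd⟩ := cs.braidWord_dvd hab dvd_rfl (show M.atom b ∣ M.atom a by rw [h])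
  have hl := M.len_le_of_dvd hd
  rw [M.len_atomProd, M.len_atom, braidWord, length_alternatingWord] at hl
  have := M.off_diagonal a b hab
  omega

/-- An element divisible by all atoms exists only if the Coxeter group is finite. -/
theorem finite_of_forall_atom_dvd [Finite A] (cs : CoxeterSystem M W) {x : M.ArtinTitsMonoid}
    (hx : ∀ a, M.atom a ∣ x) :
    Finite W := by
  have hle := cs.length_le_of_forall_isRightDescent (w := (cs.headTail x).1⁻¹)
    fun i => cs.isRightDescent_inv_iff.2 (cs.atom_dvd_iff.1 (hx i))
  have hfin := (List.finite_length_le A (cs.length (cs.headTail x).1⁻¹)).image cs.wordProd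
  refine Set.finite_univ_iff.1 (hfin.subset fun w _ => ?_)
  obtain ⟨ω, hω, rfl⟩ := cs.exists_isReduced w
  exact ⟨ω, hω.eq.symm.le.trans (hle _), rfl⟩

end CoxeterSystem

namespace CoxeterMatrix

variable {A : Type*} (M : CoxeterMatrix A)

/-- If `b` and `c` do not commute, then `c` divides `b c x` only if `b` divides `x`. -/
theorem atom_dvd_of_dvd_atom_mul_atom_mul {b c : A} (hbc : M.coxeterGraph.Adj c b)
    {x : M.ArtinTitsMonoid} (h : M.atom c ∣ M.atom b * (M.atom c * x)) : M.atom b ∣ x := by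
  have hne : b ≠ c := hbc.1.symm
  obtain ⟨hM, q, hq⟩ := M.toCoxeterSystem.braidWord_dvd hne (dvd_mul_right _ _) h
  have h1 := M.off_diagonal b c hne
  have h2 : M b c ≠ 2 := fun e => hbc.2 ((M.symmetric c b).trans e)
  obtain ⟨r, hr⟩ := M.exists_atomProd_braidWord_eq (a := b) (b := c) (by omega)
  rw [hr, mul_assoc, mul_assoc, mul_assoc] at hq
  have hx := M.toCoxeterSystem.atom_mul_left_cancel (M.toCoxeterSystem.atom_mul_left_cancel hq)
  exact ⟨_, hx⟩

end CoxeterMatrix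

/-! ### Garside families of Artin-Tits monoids -/

namespace CoxeterMatrix

variable {A : Type*} {M : CoxeterMatrix A} {S T : Set M.ArtinTitsMonoid}

theorem atom_mem_of_isGarsideFamily (hS : Garside.IsGarsideFamily S) (a : A) : M.atom a ∈ S := by
  by_contra ha
  -- As an atom is not a proper product, the elements other than `a` form a submonoid.
  let K : Submonoid M.ArtinTitsMonoid :=
    { carrier := {x | x ≠ M.atom a}
      one_mem' := fun h => M.not_isUnit_atom a (h ▸ isUnit_one)
      mul_mem' := by
        intro x y hx hy h
        have hl := M.len_mul x y
        rw [h, len_atom] at hl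
        rcases Nat.eq_zero_or_pos (M.len x) with h0 | h0
        · rw [M.len_eq_zero h0, one_mul] at h
          exact hy h
        · rw [M.len_eq_zero (x := y) (by omega), mul_one] at h
          exact hx h }
  have hK : Submonoid.closure (S ∪ {u | IsUnit u}) ≤ K := by
    rw [Submonoid.closure_le]
    rintro x (hx | hx) rfl
    · exact ha hx
    · exact M.not_isUnit_atom a hx
  rw [hS.generates] at hK
  exact hK (Submonoid.mem_top (M.atom a)) rfl

theorem exists_isHead (hSfin : S.Finite) (hS : Garside.IsGarsideFamily S)
    {x : M.ArtinTitsMonoid} (hx : x ≠ 1) : ∃ s, Garside.IsHead S x s := by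
  obtain ⟨a, y, rfl⟩ := M.exists_eq_atom_mul hx
  obtain ⟨s, ⟨hsS, hsx⟩, hmax⟩ := Set.exists_max_image
    {r | r ∈ S ∧ r ∣ M.atom a * y} M.len (hSfin.subset fun r hr => hr.1)
    ⟨M.atom a, atom_mem_of_isGarsideFamily hS a, dvd_mul_right _ _⟩
  refine ⟨s, hsS, hsx, fun r hrS hrx => ?_⟩
  obtain ⟨t, htS, hrt, hst, htx⟩ := hS.comultiples r hrS s hsS _ hrx hsx
  rwa [eq_of_dvd_of_len_le hst (hmax t ⟨htS, htx⟩)]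

theorem exists_head_mem (hSfin : S.Finite) (hS : Garside.IsGarsideFamily S)
    (hinv : Garside.HInvariant S T ∅) {a y : M.ArtinTitsMonoid} (ha : ¬ IsUnit a) (hy : y ∈ T) :
    ∃ h ∈ T, Garside.IsHead S (a * y) h := by
  have hne : a * y ≠ 1 := by
    intro h
    have hl := M.len_mul a y
    rw [h, len_one] at hl
    exact ha (by rw [M.len_eq_zero (x := a) (by omega)]; exact isUnit_one)
  obtain ⟨h, hh⟩ := exists_isHead hSfin hS hne
  exact ⟨h, hinv a ha y (Or.inl hy) h hh, hh⟩

/-- The closure under limits, applied to the sequence `x, y, x, y, …`, gives a common divisor of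
`x` and `y` in `T` that is a multiple of a given common atom. -/
theorem exists_common_divisor_mem (hSfin : S.Finite) (hS : Garside.IsGarsideFamily S)
    (hmax : Garside.MaxClosed S T ∅) {x y : M.ArtinTitsMonoid} (hx : x ∈ T) (hy : y ∈ T) {b : A}
    (hbx : M.atom b ∣ x) (hby : M.atom b ∣ y) :
    ∃ s ∈ T, M.atom b ∣ s ∧ s ∣ x ∧ s ∣ y := by
  obtain ⟨s, ⟨hsS, hbs, hsx, hsy⟩, hs⟩ := Set.exists_max_image
    {r | r ∈ S ∧ M.atom b ∣ r ∧ r ∣ x ∧ r ∣ y} M.len (hSfin.subset fun r hr => hr.1)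
    ⟨M.atom b, atom_mem_of_isGarsideFamily hS b, dvd_rfl, hbx, hby⟩
  refine ⟨s, ?_, hbs, hsx, hsy⟩
  have hT : s ∈ T ∪ ∅ := by
    refine hmax (fun i => if Even i then x else y) (fun i => ?_) s hsS ⟨⟨Or.inl hsS, ?_⟩, ?_⟩
    · split_ifs
      · exact hx
      · exact hy
    · refine Filter.Eventually.of_forall fun i => ?_
      dsimp only
      split_ifs
      · exact hsx
      · exact hsy
    · rintro r ⟨hr, hev⟩ hsr
      obtain ⟨N, hN⟩ := Filter.eventually_atTop.1 hev
      have hrx : r ∣ x := by simpa using hN (2 * N) (by omega)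
      have hry : r ∣ y := by simpa [Nat.even_add_one] using hN (2 * N + 1) (by omega)
      rcases hr with hrS | rfl
      · rw [eq_of_dvd_of_len_le hsr (hs r ⟨hrS, hbs.trans hsr, hrx, hry⟩)]
      · exact one_dvd s
  simpa using hT

/-- The atoms dividing all elements of `T` are closed under adjacency in the Coxeter graph, so
that, in the irreducible case, one such atom forces all atoms to divide all elements of `T`. -/
theorem atom_dvd_of_forall_atom_dvd (hirr : M.IsIrreducible) (hSfin : S.Finite)
    (hS : Garside.IsGarsideFamily S) (hinv : Garside.HInvariant S T ∅) {c : A}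
    (hc : ∀ y ∈ T, M.atom c ∣ y) (d : A) : ∀ y ∈ T, M.atom d ∣ y := by
  obtain ⟨p⟩ := hirr.preconnected c d
  induction p with
  | nil => exact hc
  | @cons c b d hadj p ih =>
    refine ih fun y hy => ?_
    have hu : ¬ IsUnit (M.atom b * M.atom c) := fun h => by
      have hl := M.len_mul (M.atom b) (M.atom c)
      rw [M.eq_one_of_isUnit h, len_one, len_atom, len_atom] at hl
      omega
    obtain ⟨h, hhT, -, hhd, -⟩ := exists_head_mem hSfin hS hinv hu hy
    rw [mul_assoc] at hhd
    exact M.atom_dvd_of_dvd_atom_mul_atom_mul hadj ((hc h hhT).trans hhd)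

/-- In the irreducible non-spherical case `T` contains all atoms.  A shortest element `x` of `T`
among those divisible by the atom `b` divides `b * y` for all `y ∈ T`. -/
theorem atom_mem_of_hInvariant_of_maxClosed [Finite A] (hirr : M.IsIrreducible)
    (hns : ¬ M.IsSpherical) (hSfin : S.Finite) (hS : Garside.IsGarsideFamily S)
    (hTne : T.Nonempty) (hTS : T ⊆ S) (hinv : Garside.HInvariant S T ∅)
    (hmax : Garside.MaxClosed S T ∅) (b : A) : M.atom b ∈ T := by
  have hhead : ∀ y ∈ T, ∃ h ∈ T, M.atom b ∣ h ∧ h ∣ M.atom b * y := by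
    intro y hy
    obtain ⟨h, hhT, -, hhd, hhm⟩ := exists_head_mem hSfin hS hinv (M.not_isUnit_atom b) hy
    exact ⟨h, hhT, hhm _ (atom_mem_of_isGarsideFamily hS b) (dvd_mul_right _ _), hhd⟩
  obtain ⟨y₀, hy₀⟩ := hTne
  obtain ⟨h₀, hh₀, hbh₀, -⟩ := hhead y₀ hy₀
  obtain ⟨x, ⟨hxT, hbx⟩, hmin⟩ := Set.exists_min_image {r | r ∈ T ∧ M.atom b ∣ r} M.len
    (hSfin.subset fun r hr => hTS hr.1) ⟨h₀, hh₀, hbh₀⟩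
  have hdvd : ∀ y ∈ T, x ∣ M.atom b * y := by
    intro y hy
    obtain ⟨h, hhT, hbh, hhd⟩ := hhead y hy
    obtain ⟨s, hsT, hbs, hsx, hsh⟩ := exists_common_divisor_mem hSfin hS hmax hxT hhT hbx hbh
    rw [← eq_of_dvd_of_len_le hsx (hmin s ⟨hsT, hbs⟩)]
    exact hsh.trans hhd
  obtain ⟨x', rfl⟩ := hbx
  rcases eq_or_ne x' 1 with rfl | hx'
  · simpa using hxT
  -- Otherwise an atom dividing `x'` divides all elements of `T`.
  exfalso
  obtain ⟨c, x'', rfl⟩ := M.exists_eq_atom_mul hx'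
  have hc : ∀ y ∈ T, M.atom c ∣ y := by
    intro y hy
    obtain ⟨q, hq⟩ := hdvd y hy
    rw [mul_assoc, mul_assoc] at hq
    exact ⟨_, M.toCoxeterSystem.atom_mul_left_cancel hq⟩
  exact hns (M.toCoxeterSystem.finite_of_forall_atom_dvd fun d =>
    atom_dvd_of_forall_atom_dvd hirr hSfin hS hinv hc d y₀ hy₀)

end CoxeterMatrix

theorem mainTheorem9 {A : Type*} (M : CoxeterMatrix A)
    (hfg : Monoid.FG M.ArtinTitsMonoid) (hirr : M.IsIrreducible) (hns : ¬ M.IsSpherical)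
    (S : Set M.ArtinTitsMonoid) (hSfin : S.Finite) (hS : Garside.IsGarsideFamily S)
    (T : Set M.ArtinTitsMonoid) (hTS : T ⊆ S) (hTne : T.Nonempty)
    (hadm : Garside.Admissible S T ∅) (hinv : Garside.HInvariant S T ∅)
    (hmax : Garside.MaxClosed S T ∅) :
    Set.range M.atom ⊆ T ∧ T = S := by
  have hinj : Function.Injective M.atom := M.toCoxeterSystem.atom_injective
  have hA : Finite A := (Set.finite_range_iff hinj).1 (hSfin.subset
    (Set.range_subset_iff.2 (CoxeterMatrix.atom_mem_of_isGarsideFamily hS)))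
  have hatom : ∀ b, M.atom b ∈ T :=
    CoxeterMatrix.atom_mem_of_hInvariant_of_maxClosed hirr hns hSfin hS hTne hTS hinv hmax
  refine ⟨Set.range_subset_iff.2 hatom, hTS.antisymm fun s hs => ?_⟩
  rcases eq_or_ne s 1 with rfl | hs1
  · -- If `1 ∈ S`, then `1` is the limit of a sequence alternating between two distinct atoms.
    obtain ⟨a⟩ := hirr.nonempty
    obtain ⟨b, hb⟩ : ∃ b, ¬ M.atom b ∣ M.atom a := by
      by_contra! hall
      exact hns (M.toCoxeterSystem.finite_of_forall_atom_dvd hall)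
    have h1 : (1 : M.ArtinTitsMonoid) ∈ T ∪ ∅ := by
      refine hmax (fun i => if Even i then M.atom a else M.atom b) (fun i => ?_) 1 hs
        ⟨⟨Or.inl hs, Filter.Eventually.of_forall fun i => one_dvd _⟩, ?_⟩
      · split_ifs <;> exact hatom _
      · rintro r ⟨-, hev⟩ -
        obtain ⟨N, hN⟩ := Filter.eventually_atTop.1 hev
        have hra : r ∣ M.atom a := by simpa using hN (2 * N) (by omega)
        have hrb : r ∣ M.atom b := by simpa [Nat.even_add_one] using hN (2 * N + 1) (by omega)
        by_contra hr
        obtain ⟨c, y, rfl⟩ := M.exists_eq_atom_mul (x := r) (by rintro rfl; exact hr dvd_rfl)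
        have e : M.atom c = M.atom b := CoxeterMatrix.eq_of_dvd_of_len_le
          ((dvd_mul_right _ _).trans hrb) (by rw [M.len_atom, M.len_atom])
        exact hb (e ▸ (dvd_mul_right _ _).trans hra)
    simpa using h1
  · -- Write the element as `y * b` with an atom `b`; it is its own head.
    obtain ⟨b, y, rfl⟩ := M.exists_eq_mul_atom hs1
    by_cases hy : IsUnit y
    · rw [M.eq_one_of_isUnit hy, one_mul]
      exact hatom b
    · exact hinv y hy _ (Or.inl (hatom b)) _ ⟨hs, dvd_rfl, fun r _ hr => hr⟩
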